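/- Terminology. A real random variable $X$ is \emph{$L$-subgaussian} if $\Pr[|X|\ge Lu]\le 2e^{-u^2/2}$ for every $u\ge 1$. A vector $x\in\mathbb{R}^n$ is \emph{$\mu$-flat} if $\|x\|_\infty\le\mu\|x\|_2$, and \emph{$k$-sparse} if it has at most $k$ nonzero entries. Let $T_\mu\subset\mathbb{R}^n$ be the set of all $\mu$-flat vectors, and $T_{\mu,k}\subset T_\mu$ the set of those that are also $k$-sparse. For $s\in\mathbb{R}^m$ put $\phi(s)=(|s_1|^2,\dots,|s_m|^2)$. For a matrix $A\in\mathbb{R}^{m\times n}$, the mapping $x\mapsto\phi(Ax)$ is \emph{stable with constant $C>0$ in $T\subset\mathbb{R}^n$} if $\|\phi(As)-\phi(At)\|_1\ge C\,\|s-t\|_2\,\|s+t\|_2$ for all $s,t\in T$, where $\|y\|_1=\sum_{i=1}^m|y_i|$. Theorem. For every $L>0$ there exist constants $c_1,\dots,c_8>0$, depending only on $L$, such that the following holds. Let $0<\mu<\frac{1}{2\sqrt2}$ and let $m,n$ be natural numbers. Let $a\in\mathbb{R}^n$ be a random vector with independent (not necessarily identically distributed) $L$-subgaussian entries of mean zero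 and unit variance, and let $A\in\mathbb{R}^{m\times n}$ be a random matrix whose rows are independent copies of $a$. Then: (a) for every real $u\ge c_1$, if $m\ge c_2u^3\,\frac{n}{1-8\mu^2}$, then with probability at least $1-2\exp(-c_3u^2n)$ the mapping $x\mapsto\phi(Ax)$ is stable with constant $c_4(1-8\mu^2)^{1/2}$ in $T_\mu$; (b) for every integer $k$ with $1\le k\le n$ and every real $u\ge c_5$, if $m\ge c_6u^3\,\frac{k\log(en/k)}{1-8\mu^2}$, then with probability at least $1-2\exp(-c_7u^2k\log(en/k))$ the mapping $x\mapsto\phi(Ax)$ is stable with constant $c_8(1-8\mu^2)^{1/2}$ in $T_{\mu,k}$. -/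

import Mathlib

open MeasureTheory ProbabilityTheory
open scoped Matrix

namespace PhaseRetrieval

/-- A real random variable `X` is subgaussian with parameter `L` if
`Pr[|X| ≥ L u] ≤ 2 exp (-u² / 2)` for every `u ≥ 1`. -/
def IsSubgaussian {Ω : Type*} [MeasurableSpace Ω] (X : Ω → ℝ) (L : ℝ) (P : Measure Ω) : Prop :=
  ∀ u : ℝ, 1 ≤ u → P.real {ω | L * u ≤ |X ω|} ≤ 2 * Real.exp (-(u ^ 2) / 2)

/-- A vector `x ∈ ℝⁿ` is `μ`-flat if `‖x‖_∞ ≤ μ ‖x‖₂`; the norm on `Fin n → ℝ` is the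
sup norm, the norm on `EuclideanSpace ℝ (Fin n)` the Euclidean one. -/
def IsFlat {n : ℕ} (μ : ℝ) (x : EuclideanSpace ℝ (Fin n)) : Prop :=
  ‖WithLp.ofLp x‖ ≤ μ * ‖x‖

/-- A vector is `k`-sparse if it has at most `k` nonzero entries. -/
def IsSparse {n : ℕ} (k : ℕ) (x : EuclideanSpace ℝ (Fin n)) : Prop :=
  {j : Fin n | x j ≠ 0}.ncard ≤ k

/-- The set `T_μ` of all `μ`-flat vectors of `ℝⁿ`. -/
def flatSet (n : ℕ) (μ : ℝ) : Set (EuclideanSpace ℝ (Fin n)) :=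
  {x | IsFlat μ x}

/-- The set `T_{μ,k}` of all vectors of `ℝⁿ` that are both `k`-sparse and `μ`-flat. -/
def flatSparseSet (n : ℕ) (μ : ℝ) (k : ℕ) : Set (EuclideanSpace ℝ (Fin n)) :=
  {x | IsSparse k x ∧ IsFlat μ x}

/-- The map `φ : (s₁, …, s_m) ↦ (|s₁|², …, |s_m|²)`. -/
def phi {m : ℕ} (s : Fin m → ℝ) : Fin m → ℝ :=
  fun i => |s i| ^ 2

/-- The `ℓ₁` norm on `ℝᵐ`. -/
def l1norm {m : ℕ} (y : Fin m → ℝ) : ℝ :=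
  ∑ i, |y i|

/-- The mapping `x ↦ φ (A x)` is stable with constant `C` in the set `T`:
`‖φ (A s) - φ (A t)‖₁ ≥ C ‖s - t‖₂ ‖s + t‖₂` for all `s, t ∈ T`. -/
def IsStable {m n : ℕ} (A : Matrix (Fin m) (Fin n) ℝ) (C : ℝ)
    (T : Set (EuclideanSpace ℝ (Fin n))) : Prop :=
  ∀ s ∈ T, ∀ t ∈ T,
    C * ‖s - t‖ * ‖s + t‖ ≤ l1norm (phi (A *ᵥ WithLp.ofLp s) - phi (A *ᵥ WithLp.ofLp t))

/-- A random vector in `ℝⁿ` with independent `L`-subgaussian entries of mean zero and unit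
variance. The entries need not be identically distributed. -/
structure IsSubgaussianVector {Ω : Type*} [MeasurableSpace Ω] {n : ℕ}
    (a : Ω → Fin n → ℝ) (L : ℝ) (P : Measure Ω) : Prop where
  aemeasurable : AEMeasurable a P
  indep : iIndepFun (fun (j : Fin n) (ω : Ω) => a ω j) P
  subgaussian : ∀ j, IsSubgaussian (fun ω => a ω j) L P
  mean_zero : ∀ j, ∫ ω, a ω j ∂P = 0
  unit_variance : ∀ j, variance (fun ω => a ω j) P = 1

/-- A random matrix whose rows are independent copies of the random vector `a`. -/
structure HasIIDRows {Ω Ω' : Type*} [MeasurableSpace Ω] [MeasurableSpace Ω'] {m n : ℕ}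
    (A : Ω → Matrix (Fin m) (Fin n) ℝ) (P : Measure Ω)
    (a : Ω' → Fin n → ℝ) (Q : Measure Ω') : Prop where
  indep : iIndepFun (fun (i : Fin m) (ω : Ω) => (A ω i : Fin n → ℝ)) P
  identDistrib : ∀ i, IdentDistrib (fun ω => (A ω i : Fin n → ℝ)) a P Q

end PhaseRetrieval

/-!
The constants produced here do not need the factor `1 - 8 μ²`: as `8 μ² < 1`, it suffices to prove
stability with a constant depending on `L` only, for `m` at least a constant multiple of the
dimension.

Put `v = s - t` and `w = s + t`. Then `‖φ(As) - φ(At)‖₁ = ∑ |⟨aᵢ, v⟩ ⟨aᵢ, w⟩|`. By the parallelogram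
law, flatness of `s` and `t` forces all coordinates of the longer of `v` and `w`, say `w`, to be at
most `‖w‖ / 2` (`sq_apply_add_le_of_isFlat`). This excludes pairs such as `e₁ + e₂`, `e₁ - e₂`, on
which random signs always give the product `0`. For unit vectors, an induction on the number of
coordinates (`le_integral_linearForm_sq_mul_sq`) bounds `E ⟨a, v⟩² ⟨a, w⟩²` from below by
`‖v‖² ‖w‖² + 2 ⟨v, w⟩² - 2 ∑ vⱼ² wⱼ²`, hence by `1 / 2`. Subgaussian tails bound
`E ⟨a, v⟩⁴ ⟨a, w⟩⁴` from above, and together these give `E exp (-|⟨a, v⟩ ⟨a, w⟩|) ≤ e^{-c}`. So, for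
a fixed pair, Chernoff's bound makes the sum over the `m` independent rows at least a multiple of
`m` outside an event of probability `e^{-cm}` (`HasIIDRows.measureReal_sum_abs_mul_le_le`).

The bound is made uniform over the pairs in a `d`-dimensional subspace by nets of cardinality
`C ^ d`, chosen inside the set of flat vectors so that the estimate applies at the net points; the
approximation error is controlled by the operator norm of `A` on the subspace, which is of order
`√m` with the same probability (`HasIIDRows.measureReal_not_productBound_le`). For all flat vectors
the subspace is `ℝⁿ`. Two `k`-sparse vectors lie in one of at most `(n choose k)²` coordinate
subspaces of dimension at most `2 k`, and `(n choose k)² ≤ exp (2 k log (e n / k))` is absorbed into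
`e^{-cm}`.
-/

namespace PhaseRetrieval

/-! ### Subgaussian random variables -/

lemma exp_le_add_exp_sq (x : ℝ) : Real.exp x ≤ x + Real.exp (x ^ 2) := by
  have h2 := Real.add_one_le_exp (x ^ 2)
  rcases le_total |x| 1 with h | h
  · have := (abs_le.1 (Real.abs_exp_sub_one_sub_id_le h)).2
    linarith
  · rcases le_total 0 x with hx | hx
    · rw [abs_of_nonneg hx] at h
      have : Real.exp x ≤ Real.exp (x ^ 2) := Real.exp_le_exp.2 (by nlinarith)
      linarith
    · rw [abs_of_nonpos hx] at h
      have : Real.exp x ≤ 1 := Real.exp_le_one_iff.2 hx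
      nlinarith

section

variable {Ω : Type*} [MeasurableSpace Ω] {P : Measure Ω} [IsProbabilityMeasure P]

/-- The tail bound holds at every level `u ≥ 0`, because its right-hand side exceeds `1` for
`u ≤ 1`. -/
lemma IsSubgaussian.measureReal_le {X : Ω → ℝ} {L : ℝ} (h : IsSubgaussian X L P) {u : ℝ}
    (hu : 0 ≤ u) : P.real {ω | L * u ≤ |X ω|} ≤ 2 * Real.exp (-(u ^ 2) / 2) := by
  rcases le_total 1 u with h1 | h1
  · exact h u h1
  · have h2 : (1 : ℝ) / 2 ≤ Real.exp (-(u ^ 2) / 2) := by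
      have := Real.add_one_le_exp (-(u ^ 2) / 2)
      nlinarith
    have := measureReal_le_one (μ := P) (s := {ω | L * u ≤ |X ω|})
    linarith

lemma IsSubgaussian.lintegral_exp_sq_le {X : Ω → ℝ} {L : ℝ} (h : IsSubgaussian X L P)
    (hL : 0 < L) (hX : AEMeasurable X P) :
    ∫⁻ ω, ENNReal.ofReal (Real.exp (X ω ^ 2 / (4 * L ^ 2))) ∂P ≤ 3 := by
  set f : Ω → ℝ := fun ω => X ω ^ 2 / (4 * L ^ 2) with hf
  have f_nn : ∀ ω, 0 ≤ f ω := fun ω => by positivity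
  have f_meas : AEMeasurable f P := (hX.pow_const 2).div_const _
  have hsplit : ∀ ω, ENNReal.ofReal (Real.exp (f ω)) =
      ENNReal.ofReal (∫ t in (0 : ℝ)..f ω, Real.exp t) + 1 := fun ω => by
    have h1 : (0 : ℝ) ≤ Real.exp (f ω) - 1 := by simpa using f_nn ω
    rw [integral_exp, Real.exp_zero, ← ENNReal.ofReal_one, ← ENNReal.ofReal_add h1 zero_le_one]
    simp
  have htail : ∀ t ∈ Set.Ioi (0 : ℝ), P {ω | t ≤ f ω} * ENNReal.ofReal (Real.exp t) ≤
      ENNReal.ofReal (2 * Real.exp (-1 * t)) := fun t ht => by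
    have ht0 : (0 : ℝ) ≤ t := le_of_lt ht
    have hset : {ω | t ≤ f ω} = {ω | L * (2 * √t) ≤ |X ω|} := by
      ext ω
      simp only [Set.mem_ofPred_eq, hf]
      rw [le_div_iff₀ (by positivity), ← abs_of_nonneg (show 0 ≤ L * (2 * √t) by positivity),
        ← sq_le_sq]
      simp only [mul_pow, Real.sq_sqrt ht0]
      constructor <;> intro h <;> linarith
    have h1 := h.measureReal_le (u := 2 * √t) (by positivity)
    rw [← hset, mul_pow, Real.sq_sqrt ht0] at h1
    rw [← ofReal_measureReal, ← ENNReal.ofReal_mul measureReal_nonneg]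
    apply ENNReal.ofReal_le_ofReal
    calc P.real {ω | t ≤ f ω} * Real.exp t
        ≤ (2 * Real.exp (-(2 ^ 2 * t) / 2)) * Real.exp t := by gcongr
      _ = 2 * Real.exp (-1 * t) := by
        rw [mul_assoc, ← Real.exp_add]
        ring_nf
  calc ∫⁻ ω, ENNReal.ofReal (Real.exp (f ω)) ∂P
      = ∫⁻ ω, ENNReal.ofReal (∫ t in (0 : ℝ)..f ω, Real.exp t) ∂P + 1 := by
        simp_rw [hsplit]
        rw [lintegral_add_right _ measurable_const]
        simp
    _ = (∫⁻ t in Set.Ioi 0, P {ω | t ≤ f ω} * ENNReal.ofReal (Real.exp t)) + 1 := by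
        rw [lintegral_comp_eq_lintegral_meas_le_mul P (Filter.Eventually.of_forall f_nn) f_meas
          (fun t _ => Real.continuous_exp.intervalIntegrable _ _)
          (Filter.Eventually.of_forall fun t => (Real.exp_pos t).le)]
    _ ≤ (∫⁻ t in Set.Ioi 0, ENNReal.ofReal (2 * Real.exp (-1 * t))) + 1 := by
        gcongr 1
        exact setLIntegral_mono' measurableSet_Ioi htail
    _ = 3 := by
        rw [← ofReal_integral_eq_lintegral_ofReal, integral_const_mul]
        · have := integral_exp_mul_Ioi (a := (-1 : ℝ)) (by norm_num) 0
          rw [this]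
          norm_num
        · exact (integrableOn_exp_mul_Ioi (by norm_num) 0).const_mul 2
        · exact Filter.Eventually.of_forall fun t => by positivity

lemma IsSubgaussian.integrable_exp_sq {X : Ω → ℝ} {L : ℝ} (h : IsSubgaussian X L P)
    (hL : 0 < L) (hX : AEMeasurable X P) :
    Integrable (fun ω => Real.exp (X ω ^ 2 / (4 * L ^ 2))) P := by
  refine ⟨(Real.measurable_exp.comp_aemeasurable
    ((hX.pow_const 2).div_const _)).aestronglyMeasurable, ?_⟩
  rw [hasFiniteIntegral_iff_ofReal (Filter.Eventually.of_forall fun ω => (Real.exp_pos _).le)]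
  exact (h.lintegral_exp_sq_le hL hX).trans_lt (by simp)

lemma IsSubgaussian.integral_exp_sq_le {X : Ω → ℝ} {L : ℝ} (h : IsSubgaussian X L P)
    (hL : 0 < L) (hX : AEMeasurable X P) :
    ∫ ω, Real.exp (X ω ^ 2 / (4 * L ^ 2)) ∂P ≤ 3 := by
  rw [integral_eq_lintegral_of_nonneg_ae (Filter.Eventually.of_forall fun ω => (Real.exp_pos _).le)
    (h.integrable_exp_sq hL hX).aestronglyMeasurable]
  exact ENNReal.toReal_le_of_le_ofReal (by norm_num) (by simpa using h.lintegral_exp_sq_le hL hX)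

/-- A centred variable with subgaussian tails has a subgaussian moment generating function.
For `|t|` small the centring removes the linear term through `exp x ≤ x + exp (x²)`; for `|t|`
large one completes the square. -/
lemma IsSubgaussian.hasSubgaussianMGF {X : Ω → ℝ} {L : ℝ} (h : IsSubgaussian X L P)
    (hL : 0 < L) (hX : AEMeasurable X P) (h0 : ∫ ω, X ω ∂P = 0) :
    HasSubgaussianMGF X (Real.toNNReal (16 * L ^ 2)) P := by
  have hint := h.integrable_exp_sq hL hX
  have hle := h.integral_exp_sq_le hL hX
  have hbig : ∀ t ω, Real.exp (t * X ω) ≤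
      Real.exp (L ^ 2 * t ^ 2) * Real.exp (X ω ^ 2 / (4 * L ^ 2)) := fun t ω => by
    rw [← Real.exp_add, Real.exp_le_exp]
    have : L ^ 2 * t ^ 2 + X ω ^ 2 / (4 * L ^ 2) - t * X ω = (L * t - X ω / (2 * L)) ^ 2 := by
      field_simp
      ring
    nlinarith [sq_nonneg (L * t - X ω / (2 * L))]
  have hexp : ∀ t, Integrable (fun ω => Real.exp (t * X ω)) P := fun t => by
    refine (hint.const_mul (Real.exp (L ^ 2 * t ^ 2))).mono'
      (Real.measurable_exp.comp_aemeasurable (hX.const_mul t)).aestronglyMeasurable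
      (Filter.Eventually.of_forall fun ω => ?_)
    rw [Real.norm_of_nonneg (Real.exp_pos _).le]
    exact hbig t ω
  refine ⟨hexp, fun t => ?_⟩
  rw [Real.coe_toNNReal _ (by positivity), mgf]
  rcases le_total (4 * L ^ 2 * t ^ 2) 1 with ht | ht
  · set θ := 4 * L ^ 2 * t ^ 2 with hθ
    have hθ0 : 0 ≤ θ := by positivity
    -- convexity of `exp` turns the exponent `t² X²` into a multiple of `X² / (4 L²)`
    have hconv : ∀ ω, Real.exp (t * X ω) ≤
        t * X ω + ((1 - θ) + θ * Real.exp (X ω ^ 2 / (4 * L ^ 2))) := fun ω => by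
      have h1 := exp_le_add_exp_sq (t * X ω)
      have h2 := convexOn_exp.2 (Set.mem_univ (0 : ℝ)) (Set.mem_univ (X ω ^ 2 / (4 * L ^ 2)))
        (sub_nonneg.2 ht) hθ0 (by ring)
      simp only [smul_eq_mul, mul_zero, zero_add, Real.exp_zero, mul_one] at h2
      have h3 : θ * (X ω ^ 2 / (4 * L ^ 2)) = (t * X ω) ^ 2 := by
        rw [hθ]
        field_simp
      rw [h3] at h2
      linarith
    have hXint : Integrable X P := by
      have hX1 := (hexp 1).add (hexp (-1))
      refine hX1.mono' hX.aestronglyMeasurable (Filter.Eventually.of_forall fun ω => ?_)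
      have h1 := Real.add_one_le_exp (1 * X ω)
      have h2 := Real.add_one_le_exp (-1 * X ω)
      have h3 := Real.exp_pos (1 * X ω)
      have h4 := Real.exp_pos (-1 * X ω)
      rw [Real.norm_eq_abs, abs_le]
      simp only [Pi.add_apply]
      constructor <;> linarith
    have hE : Integrable (fun ω => (1 - θ) + θ * Real.exp (X ω ^ 2 / (4 * L ^ 2))) P :=
      (integrable_const _).add (hint.const_mul θ)
    calc ∫ ω, Real.exp (t * X ω) ∂P
        ≤ ∫ ω, t * X ω + ((1 - θ) + θ * Real.exp (X ω ^ 2 / (4 * L ^ 2))) ∂P :=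
          integral_mono (hexp t) ((hXint.const_mul t).add hE) hconv
      _ = (1 - θ) + θ * ∫ ω, Real.exp (X ω ^ 2 / (4 * L ^ 2)) ∂P := by
          rw [integral_add (hXint.const_mul t) hE,
            integral_add (integrable_const _) (hint.const_mul θ), integral_const_mul,
            integral_const_mul, h0]
          simp
      _ ≤ 2 * θ + 1 := by nlinarith
      _ ≤ Real.exp (2 * θ) := Real.add_one_le_exp _
      _ = Real.exp (16 * L ^ 2 * t ^ 2 / 2) := by rw [hθ]; ring_nf
  · calc ∫ ω, Real.exp (t * X ω) ∂P
        ≤ ∫ ω, Real.exp (L ^ 2 * t ^ 2) * Real.exp (X ω ^ 2 / (4 * L ^ 2)) ∂P :=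
          integral_mono (hexp t) (hint.const_mul _) (hbig t)
      _ = Real.exp (L ^ 2 * t ^ 2) * ∫ ω, Real.exp (X ω ^ 2 / (4 * L ^ 2)) ∂P :=
          integral_const_mul _ _
      _ ≤ Real.exp (L ^ 2 * t ^ 2) * Real.exp (5 * L ^ 2 * t ^ 2) := by
          gcongr
          refine hle.trans ?_
          have h1 : (3 : ℝ) ≤ Real.exp (5 / 4) := by
            have := Real.quadratic_le_exp_of_nonneg (x := 5 / 4) (by norm_num)
            norm_num at this ⊢
            linarith
          exact h1.trans (Real.exp_le_exp.2 (by linarith))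
      _ ≤ Real.exp (16 * L ^ 2 * t ^ 2 / 2) := by
          rw [← Real.exp_add, Real.exp_le_exp]
          nlinarith [sq_nonneg (L * t)]

lemma isSubgaussian_of_hasSubgaussianMGF {X : Ω → ℝ} {K : NNReal} (hK : 0 < K)
    (h : HasSubgaussianMGF X K P) : IsSubgaussian X (√K) P := by
  intro u hu
  have hK' : (0 : ℝ) < K := hK
  have hε : 0 ≤ √(K : ℝ) * u := by positivity
  have hexp : -(√(K : ℝ) * u) ^ 2 / (2 * K) = -(u ^ 2) / 2 := by
    rw [mul_pow, Real.sq_sqrt hK'.le]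
    field_simp
  have h1 := h.measure_ge_le hε
  have h2 := h.neg.measure_ge_le hε
  rw [hexp] at h1 h2
  have hsub : {ω | √(K : ℝ) * u ≤ |X ω|} ⊆
      {ω | √(K : ℝ) * u ≤ X ω} ∪ {ω | √(K : ℝ) * u ≤ (-X) ω} := fun ω hω => by
    simpa [le_abs] using hω
  have h3 := (measureReal_mono (μ := P) hsub).trans (measureReal_union_le _ _)
  linarith

end

/-! ### Fourth moments of linear forms -/

section

variable {Ω : Type*} [MeasurableSpace Ω]

/-- The random variable `X` has finite absolute moments of all orders. -/
def HasMoments (X : Ω → ℝ) (P : Measure Ω) : Prop := ∀ p : NNReal, MemLp X p P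

variable {P : Measure Ω}

lemma HasMoments.mul {X Y : Ω → ℝ} (hX : HasMoments X P) (hY : HasMoments Y P) :
    HasMoments (fun ω => X ω * Y ω) P := fun p => by
  have : ENNReal.HolderTriple ((2 * p : NNReal) : ENNReal) ((2 * p : NNReal) : ENNReal) p := by
    constructor
    push_cast
    rw [ENNReal.mul_inv (by simp) (by simp), ← add_mul, ENNReal.inv_two_add_inv_two, one_mul]
  exact (hY (2 * p)).mul' (hX (2 * p))

lemma HasMoments.add {X Y : Ω → ℝ} (hX : HasMoments X P) (hY : HasMoments Y P) :
    HasMoments (fun ω => X ω + Y ω) P := fun p => (hX p).add (hY p)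

lemma HasMoments.const_mul {X : Ω → ℝ} (hX : HasMoments X P) (c : ℝ) :
    HasMoments (fun ω => c * X ω) P := fun p => (hX p).const_mul c

lemma HasMoments.integrable {X : Ω → ℝ} (hX : HasMoments X P) : Integrable X P :=
  memLp_one_iff_integrable.1 (by simpa using hX 1)

lemma hasMoments_const [IsFiniteMeasure P] (c : ℝ) : HasMoments (fun _ : Ω => c) P :=
  fun _ => memLp_const c

lemma HasMoments.pow [IsFiniteMeasure P] {X : Ω → ℝ} (hX : HasMoments X P) (k : ℕ) :
    HasMoments (fun ω => X ω ^ k) P := by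
  induction k with
  | zero => simpa using hasMoments_const 1
  | succ k ih => simpa only [pow_succ] using ih.mul hX

lemma hasMoments_finsetSum {ι : Type*} {X : ι → Ω → ℝ} (s : Finset ι)
    (hX : ∀ j, HasMoments (X j) P) : HasMoments (fun ω => ∑ j ∈ s, X j ω) P :=
  fun p => memLp_finsetSum s fun j _ => hX j p

variable {ι : Type*} {a : ι → Ω → ℝ}

lemma integral_linearForm (hmom : ∀ j, HasMoments (a j) P) (h0 : ∀ j, ∫ ω, a j ω ∂P = 0)
    (v : ι → ℝ) (s : Finset ι) : ∫ ω, ∑ j ∈ s, v j * a j ω ∂P = 0 := by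
  rw [integral_finsetSum _ fun j _ => ((hmom j).const_mul (v j)).integrable]
  simp [integral_const_mul, h0]

lemma indepFun_pair_linearForm (hind : iIndepFun a P) (hmom : ∀ j, HasMoments (a j) P)
    (v w : ι → ℝ) {s : Finset ι} {i : ι} (hi : i ∉ s) :
    IndepFun (fun ω => (∑ j ∈ s, v j * a j ω, ∑ j ∈ s, w j * a j ω)) (a i) P := by
  have h := hind.indepFun_finset₀ s {i} (Finset.disjoint_singleton_right.2 hi)
    fun j => (hmom j).integrable.aestronglyMeasurable.aemeasurable
  have hφ : Measurable fun z : s → ℝ => (∑ j : s, v j * z j, ∑ j : s, w j * z j) := by fun_prop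
  have hψ : Measurable fun z : ({i} : Finset ι) → ℝ => z ⟨i, Finset.mem_singleton_self i⟩ :=
    measurable_pi_apply _
  have h2 := h.comp hφ hψ
  have e : (fun ω => (∑ j ∈ s, v j * a j ω, ∑ j ∈ s, w j * a j ω)) =
      (fun z : s → ℝ => (∑ j : s, v j * z j, ∑ j : s, w j * z j)) ∘ fun ω (j : s) => a j ω := by
    funext ω
    simp only [Function.comp_apply]
    rw [← Finset.sum_coe_sort s (fun j => v j * a j ω),
      ← Finset.sum_coe_sort s (fun j => w j * a j ω)]
  rw [e]
  exact h2

variable [IsProbabilityMeasure P]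

lemma integral_sum_mul_pow_of_indepFun {β : Type*} [MeasurableSpace β] {Z : Ω → β} {x : Ω → ℝ}
    (hZx : IndepFun Z x P) (hx : HasMoments x P) (N : ℕ) (g : ℕ → β → ℝ)
    (hg : ∀ k, Measurable (g k)) (hgZ : ∀ k, HasMoments (fun ω => g k (Z ω)) P) :
    ∫ ω, ∑ k ∈ Finset.range N, g k (Z ω) * x ω ^ k ∂P =
      ∑ k ∈ Finset.range N, (∫ ω, g k (Z ω) ∂P) * ∫ ω, x ω ^ k ∂P := by
  rw [integral_finsetSum _ fun k _ => ((hgZ k).mul (hx.pow k)).integrable]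
  refine Finset.sum_congr rfl fun k _ => ?_
  have h : IndepFun (fun ω => g k (Z ω)) (fun ω => x ω ^ k) P :=
    hZx.comp (hg k) (measurable_id.pow_const k)
  exact h.integral_fun_mul_eq_mul_integral (hgZ k).integrable.aestronglyMeasurable
    (hx.pow k).integrable.aestronglyMeasurable

lemma integral_linearForm_mul (hind : iIndepFun a P) (hmom : ∀ j, HasMoments (a j) P)
    (h0 : ∀ j, ∫ ω, a j ω ∂P = 0) (h1 : ∀ j, ∫ ω, a j ω ^ 2 ∂P = 1) (v w : ι → ℝ)
    (s : Finset ι) :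
    ∫ ω, (∑ j ∈ s, v j * a j ω) * (∑ j ∈ s, w j * a j ω) ∂P = ∑ j ∈ s, v j * w j := by
  classical
  induction s using Finset.induction_on with
  | empty => simp
  | insert i s hi ih =>
    have hS := hasMoments_finsetSum s fun j => (hmom j).const_mul (v j)
    have hT := hasMoments_finsetSum s fun j => (hmom j).const_mul (w j)
    let g : ℕ → ℝ × ℝ → ℝ := fun k z => match k with
      | 0 => z.1 * z.2
      | 1 => w i * z.1 + v i * z.2
      | 2 => v i * w i
      | _ => 0
    have key := integral_sum_mul_pow_of_indepFun (indepFun_pair_linearForm hind hmom v w hi)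
      (hmom i) 3 g
      (fun k => by rcases k with _ | _ | _ | k <;> simp only [g] <;> fun_prop)
      (fun k => by
        rcases k with _ | _ | _ | k
        · exact hS.mul hT
        · exact (hS.const_mul (w i)).add (hT.const_mul (v i))
        · exact hasMoments_const _
        · exact hasMoments_const _)
    simp only [Finset.sum_range_succ, Finset.sum_range_zero, g, zero_add, pow_zero, pow_one,
      mul_one, h0, h1, mul_zero, add_zero, integral_const, smul_eq_mul, probReal_univ, one_mul,
      ih] at key
    rw [Finset.sum_insert hi, add_comm (v i * w i), ← key]
    refine integral_congr_ae (Filter.Eventually.of_forall fun ω => ?_)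
    simp only [Finset.sum_insert hi]
    ring

/-- Only independence, the first two moments and `E a_j⁴ ≥ 1` enter; equality holds for signs. -/
lemma le_integral_linearForm_sq_mul_sq (hind : iIndepFun a P) (hmom : ∀ j, HasMoments (a j) P)
    (h0 : ∀ j, ∫ ω, a j ω ∂P = 0) (h1 : ∀ j, ∫ ω, a j ω ^ 2 ∂P = 1) (v w : ι → ℝ)
    (s : Finset ι) :
    (∑ j ∈ s, v j ^ 2) * (∑ j ∈ s, w j ^ 2) + 2 * (∑ j ∈ s, v j * w j) ^ 2
        - 2 * ∑ j ∈ s, v j ^ 2 * w j ^ 2 ≤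
      ∫ ω, (∑ j ∈ s, v j * a j ω) ^ 2 * (∑ j ∈ s, w j * a j ω) ^ 2 ∂P := by
  classical
  induction s using Finset.induction_on with
  | empty => simp
  | insert i s hi ih =>
    have hS := hasMoments_finsetSum s fun j => (hmom j).const_mul (v j)
    have hT := hasMoments_finsetSum s fun j => (hmom j).const_mul (w j)
    have hST := integral_linearForm_mul hind hmom h0 h1 v w s
    have hSS := integral_linearForm_mul hind hmom h0 h1 v v s
    have hTT := integral_linearForm_mul hind hmom h0 h1 w w s
    have hS0 := integral_linearForm hmom h0 v s
    have hT0 := integral_linearForm hmom h0 w s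
    have hx4 : 1 ≤ ∫ ω, a i ω ^ 4 ∂P := by
      have h2 : ∫ ω, (2 * a i ω ^ 2 - 1) ∂P ≤ ∫ ω, a i ω ^ 4 ∂P :=
        integral_mono ((((hmom i).pow 2).const_mul 2).integrable.sub (integrable_const 1))
          ((hmom i).pow 4).integrable fun ω => by nlinarith [sq_nonneg (a i ω ^ 2 - 1)]
      rw [integral_sub (((hmom i).pow 2).const_mul 2).integrable (integrable_const 1),
        integral_const_mul, h1] at h2
      norm_num at h2
      exact h2
    let g : ℕ → ℝ × ℝ → ℝ := fun k z => match k with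
      | 0 => z.1 ^ 2 * z.2 ^ 2
      | 1 => 2 * w i * (z.1 * (z.1 * z.2)) + 2 * v i * (z.2 * (z.1 * z.2))
      | 2 => w i ^ 2 * (z.1 * z.1) + (4 * v i * w i * (z.1 * z.2) + v i ^ 2 * (z.2 * z.2))
      | 3 => 2 * v i * w i ^ 2 * z.1 + 2 * v i ^ 2 * w i * z.2
      | 4 => v i ^ 2 * w i ^ 2
      | _ => 0
    have hg2 : ∫ ω, g 2 (∑ j ∈ s, v j * a j ω, ∑ j ∈ s, w j * a j ω) ∂P =
        w i ^ 2 * ∑ j ∈ s, v j * v j + (4 * v i * w i * ∑ j ∈ s, v j * w j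
          + v i ^ 2 * ∑ j ∈ s, w j * w j) := by
      simp only [g]
      rw [integral_add ((hS.mul hS).const_mul _).integrable
        (((hS.mul hT).const_mul _).add ((hT.mul hT).const_mul _)).integrable,
        integral_add ((hS.mul hT).const_mul _).integrable ((hT.mul hT).const_mul _).integrable,
        integral_const_mul, integral_const_mul, integral_const_mul, hST, hSS, hTT]
    have hg3 : ∫ ω, g 3 (∑ j ∈ s, v j * a j ω, ∑ j ∈ s, w j * a j ω) ∂P = 0 := by
      simp only [g]
      rw [integral_add (hS.const_mul _).integrable (hT.const_mul _).integrable,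
        integral_const_mul, integral_const_mul, hS0, hT0]
      simp
    have key := integral_sum_mul_pow_of_indepFun (indepFun_pair_linearForm hind hmom v w hi)
      (hmom i) 5 g
      (fun k => by rcases k with _ | _ | _ | _ | _ | k <;> simp only [g] <;> fun_prop)
      (fun k => by
        rcases k with _ | _ | _ | _ | _ | k
        · exact (hS.pow 2).mul (hT.pow 2)
        · exact ((hS.mul (hS.mul hT)).const_mul _).add ((hT.mul (hS.mul hT)).const_mul _)
        · exact ((hS.mul hS).const_mul _).add
            (((hS.mul hT).const_mul _).add ((hT.mul hT).const_mul _))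
        · exact (hS.const_mul _).add (hT.const_mul _)
        · exact hasMoments_const _
        · exact hasMoments_const _)
    simp only [Finset.sum_range_succ, Finset.sum_range_zero, zero_add, hg2, hg3] at key
    simp only [g, pow_zero, pow_one, mul_one, h0, h1, mul_zero, zero_mul, add_zero,
      integral_const, smul_eq_mul, probReal_univ, one_mul] at key
    have hcongr : ∫ ω, (∑ j ∈ insert i s, v j * a j ω) ^ 2
          * (∑ j ∈ insert i s, w j * a j ω) ^ 2 ∂P =
        (∫ ω, (∑ j ∈ s, v j * a j ω) ^ 2 * (∑ j ∈ s, w j * a j ω) ^ 2 ∂P) +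
          (w i ^ 2 * ∑ j ∈ s, v j * v j + (4 * v i * w i * ∑ j ∈ s, v j * w j
            + v i ^ 2 * ∑ j ∈ s, w j * w j)) + v i ^ 2 * w i ^ 2 * ∫ ω, a i ω ^ 4 ∂P := by
      rw [← key]
      refine integral_congr_ae (Filter.Eventually.of_forall fun ω => ?_)
      simp only [Finset.sum_insert hi]
      ring
    rw [hcongr]
    simp only [Finset.sum_insert hi, ← sq]
    have h5 : v i ^ 2 * w i ^ 2 * 1 ≤ v i ^ 2 * w i ^ 2 * ∫ ω, a i ω ^ 4 ∂P := by gcongr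
    nlinarith

end

/-! ### A single row -/

/-- The constant bounding `E ⟨a, v⟩⁴ ⟨a, w⟩⁴` for unit vectors `v`, `w` and a random vector `a` with
independent centred `L`-subgaussian entries. The summand `1` makes `momentConst L ≥ 1` evident. -/
noncomputable def momentConst (L : ℝ) : ℝ := 72 * (64 * L ^ 2) ^ 4 + 1

lemma one_le_momentConst (L : ℝ) : 1 ≤ momentConst L := by
  unfold momentConst
  have : 0 ≤ 72 * (64 * L ^ 2) ^ 4 := by positivity
  linarith

/-- A bound of `exp (-|z|)` by a polynomial in `z²`, whose expectation is controlled by a lower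
bound on `E z²` and an upper bound on `E z⁴`. -/
lemma exp_neg_abs_le {α : ℝ} (h0 : 0 < α) (h1 : α ≤ 1 / 2) (z : ℝ) :
    Real.exp (-|z|) ≤ 1 - α * z ^ 2 + α ^ 2 / 2 * z ^ 4 := by
  have hz := abs_nonneg z
  have h2 : Real.exp (-|z|) ≤ 1 / (1 + |z|) := by
    rw [Real.exp_neg, ← one_div]
    exact one_div_le_one_div_of_le (by linarith) (by linarith [Real.add_one_le_exp |z|])
  refine h2.trans ?_
  rw [div_le_iff₀ (by linarith)]
  have h4 : z ^ 4 = |z| ^ 4 := by rw [← abs_pow]; exact (abs_of_nonneg (by positivity)).symm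
  rw [h4, ← sq_abs z]
  set y := |z|
  rcases le_total y 1 with hy | hy
  · have h5 : 0 ≤ y * (1 - α * y * (1 + y)) := mul_nonneg hz (by nlinarith [mul_nonneg hz h0.le])
    have h6 : 0 ≤ α ^ 2 / 2 * y ^ 4 * (1 + y) := by positivity
    nlinarith
  · have h5 : 1 / 2 ≤ 1 - α * y ^ 2 + α ^ 2 / 2 * y ^ 4 := by nlinarith [sq_nonneg (α * y ^ 2 - 1)]
    nlinarith

section

variable {Ω : Type*} [MeasurableSpace Ω] {n : ℕ} {a : Ω → Fin n → ℝ} {L : ℝ} {Q : Measure Ω}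

lemma IsSubgaussianVector.aemeasurable_apply (h : IsSubgaussianVector a L Q) (j : Fin n) :
    AEMeasurable (fun ω => a ω j) Q :=
  (measurable_pi_apply j).comp_aemeasurable h.aemeasurable

lemma IsSubgaussianVector.integral_sq (h : IsSubgaussianVector a L Q) (j : Fin n) :
    ∫ ω, a ω j ^ 2 ∂Q = 1 := by
  rw [← variance_of_integral_eq_zero (h.aemeasurable_apply j) (h.mean_zero j)]
  exact h.unit_variance j

variable [IsProbabilityMeasure Q]

lemma IsSubgaussianVector.hasSubgaussianMGF (h : IsSubgaussianVector a L Q) (hL : 0 < L)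
    (j : Fin n) : HasSubgaussianMGF (fun ω => a ω j) (Real.toNNReal (16 * L ^ 2)) Q :=
  (h.subgaussian j).hasSubgaussianMGF hL (h.aemeasurable_apply j) (h.mean_zero j)

lemma IsSubgaussianVector.hasMoments (h : IsSubgaussianVector a L Q) (hL : 0 < L)
    (j : Fin n) : HasMoments (fun ω => a ω j) Q :=
  (h.hasSubgaussianMGF hL j).memLp

lemma IsSubgaussianVector.hasMoments_dotProduct (h : IsSubgaussianVector a L Q) (hL : 0 < L)
    (v : Fin n → ℝ) : HasMoments (fun ω => a ω ⬝ᵥ v) Q := by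
  have := hasMoments_finsetSum Finset.univ fun j => (h.hasMoments hL j).const_mul (v j)
  simpa only [dotProduct, mul_comm] using this

/-- Linear forms with unit coefficient vector inherit the subgaussian tails of the entries, with
a constant independent of the dimension. -/
lemma IsSubgaussianVector.isSubgaussian_dotProduct (h : IsSubgaussianVector a L Q) (hL : 0 < L)
    {v : EuclideanSpace ℝ (Fin n)} (hv : ‖v‖ = 1) :
    IsSubgaussian (fun ω => a ω ⬝ᵥ v.ofLp) (4 * L) Q := by
  have hK : 0 < Real.toNNReal (16 * L ^ 2) := by simpa using pow_pos hL 2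
  have hsq : ∑ j, v j ^ 2 = 1 := by rw [← EuclideanSpace.real_norm_sq_eq, hv, one_pow]
  have hind : iIndepFun (fun j ω => v j * a ω j) Q :=
    h.indep.comp (fun j x => v j * x) fun j => measurable_id.const_mul _
  have hj : ∀ j, HasSubgaussianMGF (fun ω => v j * a ω j)
      (Real.toNNReal (v j ^ 2) * Real.toNNReal (16 * L ^ 2)) Q := fun j => by
    rw [Real.toNNReal_of_nonneg (sq_nonneg (v j))]
    exact (h.hasSubgaussianMGF hL j).const_mul (v j)
  have h1 := HasSubgaussianMGF.sum_of_iIndepFun hind (s := Finset.univ) fun j _ => hj j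
  rw [← Finset.sum_mul, ← Real.toNNReal_sum_of_nonneg fun j _ => sq_nonneg (v j), hsq,
    Real.toNNReal_one, one_mul] at h1
  have h3 := isSubgaussian_of_hasSubgaussianMGF hK h1
  rw [Real.coe_toNNReal _ (by positivity), show 16 * L ^ 2 = (4 * L) ^ 2 by ring,
    Real.sqrt_sq (by positivity)] at h3
  simpa only [dotProduct, mul_comm] using h3

lemma IsSubgaussianVector.integral_exp_sq_dotProduct_le (h : IsSubgaussianVector a L Q)
    (hL : 0 < L) {v : EuclideanSpace ℝ (Fin n)} (hv : ‖v‖ = 1) :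
    Integrable (fun ω => Real.exp ((a ω ⬝ᵥ v.ofLp) ^ 2 / (64 * L ^ 2))) Q ∧
      ∫ ω, Real.exp ((a ω ⬝ᵥ v.ofLp) ^ 2 / (64 * L ^ 2)) ∂Q ≤ 3 := by
  have hs := h.isSubgaussian_dotProduct hL hv
  have hm := (h.hasMoments_dotProduct hL v.ofLp).integrable.aestronglyMeasurable.aemeasurable
  have e : 64 * L ^ 2 = 4 * (4 * L) ^ 2 := by ring
  rw [e]
  exact ⟨hs.integrable_exp_sq (by positivity) hm, hs.integral_exp_sq_le (by positivity) hm⟩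

lemma IsSubgaussianVector.integral_dotProduct_pow_eight_le (h : IsSubgaussianVector a L Q)
    (hL : 0 < L) {v : EuclideanSpace ℝ (Fin n)} (hv : ‖v‖ = 1) :
    ∫ ω, (a ω ⬝ᵥ v.ofLp) ^ 8 ∂Q ≤ momentConst L := by
  obtain ⟨hint, hle⟩ := h.integral_exp_sq_dotProduct_le hL hv
  calc ∫ ω, (a ω ⬝ᵥ v.ofLp) ^ 8 ∂Q
      ≤ ∫ ω, 24 * (64 * L ^ 2) ^ 4 * Real.exp ((a ω ⬝ᵥ v.ofLp) ^ 2 / (64 * L ^ 2)) ∂Q := by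
        refine integral_mono ((h.hasMoments_dotProduct hL _).pow 8).integrable
          (hint.const_mul _) fun ω => ?_
        have h1 := Real.pow_div_factorial_le_exp
          (x := (a ω ⬝ᵥ v.ofLp) ^ 2 / (64 * L ^ 2)) (by positivity) 4
        calc (a ω ⬝ᵥ v.ofLp) ^ 8
            = 24 * (64 * L ^ 2) ^ 4 * (((a ω ⬝ᵥ v.ofLp) ^ 2 / (64 * L ^ 2)) ^ 4
                / (Nat.factorial 4 : ℕ)) := by
              norm_num [Nat.factorial]
              field_simp
          _ ≤ _ := by gcongr
    _ ≤ 24 * (64 * L ^ 2) ^ 4 * 3 := by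
        rw [integral_const_mul]
        gcongr
    _ ≤ momentConst L := by
        unfold momentConst
        linarith

/-- Some flatness of one vector is needed: for random signs the integral vanishes when
`w = (e₁ + e₂) / √2` and `v = (e₁ - e₂) / √2`. -/
lemma IsSubgaussianVector.le_integral_dotProduct_sq_mul_sq (h : IsSubgaussianVector a L Q)
    (hL : 0 < L) {v w : EuclideanSpace ℝ (Fin n)} (hv : ‖v‖ = 1) (hw : ‖w‖ = 1)
    (hflat : ∀ j, w j ^ 2 ≤ 1 / 4) :
    1 / 2 ≤ ∫ ω, (a ω ⬝ᵥ v.ofLp) ^ 2 * (a ω ⬝ᵥ w.ofLp) ^ 2 ∂Q := by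
  have hv2 : ∑ j, v j ^ 2 = 1 := by rw [← EuclideanSpace.real_norm_sq_eq, hv, one_pow]
  have hw2 : ∑ j, w j ^ 2 = 1 := by rw [← EuclideanSpace.real_norm_sq_eq, hw, one_pow]
  have h1 := le_integral_linearForm_sq_mul_sq h.indep (h.hasMoments hL) h.mean_zero h.integral_sq
    v.ofLp w.ofLp Finset.univ
  have h2 : ∑ j, v j ^ 2 * w j ^ 2 ≤ 1 / 4 := by
    calc ∑ j, v j ^ 2 * w j ^ 2 ≤ ∑ j, v j ^ 2 * (1 / 4) :=
          Finset.sum_le_sum fun j _ => mul_le_mul_of_nonneg_left (hflat j) (sq_nonneg _)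
      _ = 1 / 4 := by rw [← Finset.sum_mul, hv2, one_mul]
  simp only [hv2, hw2] at h1
  simp only [dotProduct, mul_comm (a _ _)]
  nlinarith [sq_nonneg (∑ j, v j * w j)]

/-- The Laplace transform of `|⟨a, v⟩ ⟨a, w⟩|` at `1` is bounded away from `1`, by second and fourth
moments of the product. -/
lemma IsSubgaussianVector.integral_exp_neg_abs_le (h : IsSubgaussianVector a L Q)
    (hL : 0 < L) {v w : EuclideanSpace ℝ (Fin n)} (hv : ‖v‖ = 1) (hw : ‖w‖ = 1)
    (hflat : ∀ j, w j ^ 2 ≤ 1 / 4) :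
    Integrable (fun ω => Real.exp (-|(a ω ⬝ᵥ v.ofLp) * (a ω ⬝ᵥ w.ofLp)|)) Q ∧
      ∫ ω, Real.exp (-|(a ω ⬝ᵥ v.ofLp) * (a ω ⬝ᵥ w.ofLp)|) ∂Q
        ≤ Real.exp (-(1 / (8 * momentConst L))) := by
  set M := momentConst L
  have hM1 : 1 ≤ M := one_le_momentConst L
  have hV := h.hasMoments_dotProduct hL v.ofLp
  have hW := h.hasMoments_dotProduct hL w.ofLp
  set X : Ω → ℝ := fun ω => a ω ⬝ᵥ v.ofLp
  set Y : Ω → ℝ := fun ω => a ω ⬝ᵥ w.ofLp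
  have hXY := hV.mul hW
  have h2 : 1 / 2 ≤ ∫ ω, (X ω * Y ω) ^ 2 ∂Q := by
    simpa only [mul_pow] using h.le_integral_dotProduct_sq_mul_sq hL hv hw hflat
  have h4 : ∫ ω, (X ω * Y ω) ^ 4 ∂Q ≤ M := by
    have hVi := (hV.pow 8).integrable
    have hWi := (hW.pow 8).integrable
    calc ∫ ω, (X ω * Y ω) ^ 4 ∂Q ≤ ∫ ω, (1 / 2) * (X ω ^ 8 + Y ω ^ 8) ∂Q :=
          integral_mono (hXY.pow 4).integrable ((hVi.add hWi).const_mul _) fun ω => by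
            nlinarith [sq_nonneg (X ω ^ 4 - Y ω ^ 4)]
      _ = (1 / 2) * (∫ ω, X ω ^ 8 ∂Q + ∫ ω, Y ω ^ 8 ∂Q) := by
          rw [integral_const_mul, integral_add hVi hWi]
      _ ≤ M := by
          have := h.integral_dotProduct_pow_eight_le hL hv
          have := h.integral_dotProduct_pow_eight_le hL hw
          linarith
  have hint : Integrable (fun ω => Real.exp (-|X ω * Y ω|)) Q := by
    refine (integrable_const (1 : ℝ)).mono'
      (Real.continuous_exp.comp_aestronglyMeasurable
        (continuous_abs.comp_aestronglyMeasurable hXY.integrable.aestronglyMeasurable).neg)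
      (Filter.Eventually.of_forall fun ω => ?_)
    rw [Real.norm_of_nonneg (Real.exp_pos _).le, Real.exp_le_one_iff]
    exact neg_nonpos.2 (abs_nonneg _)
  refine ⟨hint, ?_⟩
  -- this value of `α` minimizes `1 - α / 2 + α² M / 2`
  set α := 1 / (2 * M) with hα
  have hα0 : 0 < α := by positivity
  have hα1 : α ≤ 1 / 2 := one_div_le_one_div_of_le (by norm_num) (by linarith)
  have hi2 := ((hXY.pow 2).const_mul α).integrable
  have hi4 := ((hXY.pow 4).const_mul (α ^ 2 / 2)).integrable
  have hi12 : Integrable (fun ω => 1 - α * (X ω * Y ω) ^ 2) Q := (integrable_const _).sub hi2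
  calc ∫ ω, Real.exp (-|X ω * Y ω|) ∂Q
      ≤ ∫ ω, 1 - α * (X ω * Y ω) ^ 2 + α ^ 2 / 2 * (X ω * Y ω) ^ 4 ∂Q :=
        integral_mono hint (hi12.add hi4) fun ω => exp_neg_abs_le hα0 hα1 _
    _ = 1 - α * ∫ ω, (X ω * Y ω) ^ 2 ∂Q + α ^ 2 / 2 * ∫ ω, (X ω * Y ω) ^ 4 ∂Q := by
        rw [integral_add hi12 hi4, integral_sub (integrable_const _) hi2, integral_const_mul,
          integral_const_mul]
        simp
    _ ≤ 1 - α * (1 / 2) + α ^ 2 / 2 * M := by gcongr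
    _ = -(1 / (8 * M)) + 1 := by
        rw [hα]
        field_simp
        ring
    _ ≤ Real.exp (-(1 / (8 * M))) := Real.add_one_le_exp _

end

/-! ### Deviation bounds for fixed vectors -/

section

variable {Ω Ω' : Type*} [MeasurableSpace Ω] [MeasurableSpace Ω'] {m n : ℕ}
  {A : Ω → Matrix (Fin m) (Fin n) ℝ} {P : Measure Ω} [IsProbabilityMeasure P]
  {a : Ω' → Fin n → ℝ} {Q : Measure Ω'}

/-- Chernoff's bound for sums over independent copies of the row `a`. -/
lemma HasIIDRows.measureReal_sum_ge_le (hA : HasIIDRows A P a Q) {f : (Fin n → ℝ) → ℝ}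
    (hf : Measurable f) {q : ℝ} (hint : Integrable (fun ω => Real.exp (f (a ω))) Q)
    (hq : ∫ ω, Real.exp (f (a ω)) ∂Q ≤ Real.exp q) (τ : ℝ) :
    P.real {ω | τ ≤ ∑ i, f (A ω i)} ≤ Real.exp (m * q - τ) := by
  have hid : ∀ i, IdentDistrib (fun ω => f (A ω i)) (fun ω => f (a ω)) P Q :=
    fun i => (hA.identDistrib i).comp hf
  have hide : ∀ i, IdentDistrib (fun ω => Real.exp (f (A ω i)))
      (fun ω => Real.exp (f (a ω))) P Q := fun i => (hid i).comp Real.measurable_exp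
  have hind : iIndepFun (fun i ω => f (A ω i)) P := hA.indep.comp (fun _ => f) fun _ => hf
  have hmgf1 : ∀ i, mgf (fun ω => f (A ω i)) P 1 = ∫ ω, Real.exp (f (a ω)) ∂Q := fun i => by
    simp only [mgf, one_mul]
    exact (hide i).integral_eq
  have hsum := hind.mgf_sum₀ (t := 1) (fun i => (hid i).aemeasurable_fst) Finset.univ
  have hpos : 0 < mgf (∑ i, fun ω => f (A ω i)) P 1 := by
    rw [hsum]
    refine Finset.prod_pos fun i _ => ?_
    refine mgf_pos (by simpa using (hide i).integrable_iff.2 hint)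
  have hsumint : Integrable (fun ω => Real.exp (1 * (∑ i, fun ω => f (A ω i)) ω)) P := by
    by_contra hcon
    rw [mgf_undef hcon] at hpos
    exact lt_irrefl _ hpos
  have hch := measure_ge_le_exp_mul_mgf τ zero_le_one hsumint
  have hprod : mgf (∑ i, fun ω => f (A ω i)) P 1 ≤ Real.exp (m * q) := by
    rw [hsum, Real.exp_nat_mul]
    calc ∏ i : Fin m, mgf (fun ω => f (A ω i)) P 1 ≤ ∏ _i : Fin m, Real.exp q :=
          Finset.prod_le_prod (fun i _ => mgf_nonneg) fun i _ => (hmgf1 i).trans_le hq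
      _ = Real.exp q ^ m := by simp
  simp only [Finset.sum_apply] at hch
  refine hch.trans ((mul_le_mul_of_nonneg_left hprod (Real.exp_pos _).le).trans_eq ?_)
  rw [← Real.exp_add]
  ring_nf

variable [IsProbabilityMeasure Q] {L : ℝ}

/-- The threshold `192 L² m = 3 m · 64 L²` beats the exponential moment
`E exp (⟨a, v⟩² / (64 L²)) ≤ 3 ≤ e²` of a row. -/
lemma HasIIDRows.measureReal_sum_sq_ge_le (hA : HasIIDRows A P a Q)
    (ha : IsSubgaussianVector a L Q) (hL : 0 < L) {v : EuclideanSpace ℝ (Fin n)}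
    (hv : ‖v‖ = 1) :
    P.real {ω | 192 * L ^ 2 * m ≤ ∑ i, ((A ω *ᵥ v.ofLp) i) ^ 2} ≤ Real.exp (-m) := by
  obtain ⟨hint, hle⟩ := ha.integral_exp_sq_dotProduct_le hL hv
  have h3 : (3 : ℝ) ≤ Real.exp 2 := by linarith [Real.add_one_le_exp (2 : ℝ)]
  have h := hA.measureReal_sum_ge_le (f := fun x => (x ⬝ᵥ v.ofLp) ^ 2 / (64 * L ^ 2))
    (by simp only [dotProduct]; fun_prop) hint (hle.trans h3) (3 * m)
  have hset : {ω | 192 * L ^ 2 * m ≤ ∑ i, ((A ω *ᵥ v.ofLp) i) ^ 2} =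
      {ω | 3 * (m : ℝ) ≤ ∑ i, (A ω i ⬝ᵥ v.ofLp) ^ 2 / (64 * L ^ 2)} := by
    ext ω
    simp only [Set.mem_ofPred_eq, Matrix.mulVec]
    rw [← Finset.sum_div, le_div_iff₀ (by positivity)]
    constructor <;> intro h <;> linarith
  rw [hset]
  exact h.trans (Real.exp_le_exp.2 (by linarith))

lemma HasIIDRows.measureReal_sum_abs_mul_le_le (hA : HasIIDRows A P a Q)
    (ha : IsSubgaussianVector a L Q) (hL : 0 < L) {v w : EuclideanSpace ℝ (Fin n)}
    (hv : ‖v‖ = 1) (hw : ‖w‖ = 1) (hflat : ∀ j, w j ^ 2 ≤ 1 / 4) :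
    P.real {ω | ∑ i, |(A ω *ᵥ v.ofLp) i * (A ω *ᵥ w.ofLp) i| ≤ m / (16 * momentConst L)} ≤
      Real.exp (-(m / (16 * momentConst L))) := by
  obtain ⟨hint, hle⟩ := ha.integral_exp_neg_abs_le hL hv hw hflat
  have h := hA.measureReal_sum_ge_le (f := fun x => -|(x ⬝ᵥ v.ofLp) * (x ⬝ᵥ w.ofLp)|)
    (by simp only [dotProduct]; fun_prop) hint hle (-(m / (16 * momentConst L)))
  have hset : {ω | ∑ i, |(A ω *ᵥ v.ofLp) i * (A ω *ᵥ w.ofLp) i| ≤ m / (16 * momentConst L)} =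
      {ω | -(m / (16 * momentConst L)) ≤ ∑ i, -|(A ω i ⬝ᵥ v.ofLp) * (A ω i ⬝ᵥ w.ofLp)|} := by
    ext ω
    simp only [Set.mem_ofPred_eq, Matrix.mulVec, Finset.sum_neg_distrib, neg_le_neg_iff]
  rw [hset]
  refine h.trans_eq ?_
  have := one_le_momentConst L
  congr 1
  field_simp
  ring

end

/-! ### Nets -/

section

variable {E : Type*} [NormedAddCommGroup E] [NormedSpace ℝ E] [FiniteDimensional ℝ E]

/-- The disjoint balls of radius `ε / 2` around the points lie in the ball of radius `1 + ε / 2`. -/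
lemma card_le_of_separated_of_norm_le_one {ε : ℝ} (hε : 0 < ε) (s : Finset E)
    (hs : ∀ c ∈ s, ‖c‖ ≤ 1) (hsep : ∀ c ∈ s, ∀ d ∈ s, c ≠ d → ε ≤ ‖c - d‖) :
    (s.card : ℝ) ≤ (1 + 2 / ε) ^ Module.finrank ℝ E := by
  borelize E
  let ν : Measure E := Measure.addHaar
  set δ := ε / 2 with hδ
  have hδ0 : 0 < δ := by positivity
  have hdisj : Set.Pairwise (s : Set E)
      (Function.onFun Disjoint fun c => Metric.ball (c : E) δ) := by
    rintro c hc d hd hcd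
    apply Metric.ball_disjoint_ball
    rw [dist_eq_norm]
    linarith [hsep c hc d hd hcd]
  have hsub : ⋃ c ∈ s, Metric.ball (c : E) δ ⊆ Metric.ball (0 : E) (1 + δ) := by
    refine Set.iUnion₂_subset fun x hx => Metric.ball_subset_ball' ?_
    rw [dist_zero_right]
    linarith [hs x hx]
  have hvol : (s.card : ENNReal) * ENNReal.ofReal (δ ^ Module.finrank ℝ E) * ν (Metric.ball 0 1) ≤
      ENNReal.ofReal ((1 + δ) ^ Module.finrank ℝ E) * ν (Metric.ball 0 1) :=
    calc (s.card : ENNReal) * ENNReal.ofReal (δ ^ Module.finrank ℝ E) * ν (Metric.ball 0 1)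
        = ν (⋃ c ∈ s, Metric.ball (c : E) δ) := by
          rw [measure_biUnion_finset hdisj fun c _ => measurableSet_ball]
          simp only [ν.addHaar_ball_of_pos _ hδ0, Finset.sum_const, nsmul_eq_mul, mul_assoc]
      _ ≤ ν (Metric.ball (0 : E) (1 + δ)) := measure_mono hsub
      _ = _ := ν.addHaar_ball_of_pos _ (by positivity)
  have hcard := (ENNReal.mul_le_mul_iff_left (Metric.measure_ball_pos _ _ zero_lt_one).ne'
    measure_ball_lt_top.ne).1 hvol
  have h := ENNReal.toReal_le_of_le_ofReal (by positivity) hcard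
  rw [ENNReal.toReal_mul, ENNReal.toReal_natCast, ENNReal.toReal_ofReal (by positivity),
    ← le_div_iff₀ (by positivity), ← div_pow] at h
  refine h.trans_eq ?_
  congr 1
  rw [hδ]
  field_simp
  ring

/-- The net can be taken inside any prescribed subset of the unit ball. -/
lemma exists_net {ε : ℝ} (hε : 0 < ε) {S : Set E} (hS : ∀ x ∈ S, ‖x‖ ≤ 1) :
    ∃ N : Finset E, (∀ x ∈ N, x ∈ S) ∧ (∀ x ∈ S, ∃ y ∈ N, ‖x - y‖ ≤ ε) ∧
      (N.card : ℝ) ≤ (1 + 2 / ε) ^ Module.finrank ℝ E := by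
  classical
  -- a separated subset of maximal cardinality is a net
  let C : Set ℕ := {k | ∃ N : Finset E, (∀ x ∈ N, x ∈ S) ∧
    (∀ c ∈ N, ∀ d ∈ N, c ≠ d → ε ≤ ‖c - d‖) ∧ N.card = k}
  have hC0 : C.Nonempty := ⟨0, ∅, by simp⟩
  have hCb : BddAbove C := by
    refine ⟨⌊(1 + 2 / ε) ^ Module.finrank ℝ E⌋₊, ?_⟩
    rintro k ⟨N, hN, hsep, rfl⟩
    exact Nat.le_floor (card_le_of_separated_of_norm_le_one hε N (fun c hc => hS c (hN c hc)) hsep)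
  obtain ⟨N, hN, hsep, hcard⟩ := Nat.sSup_mem hC0 hCb
  refine ⟨N, hN, ?_, card_le_of_separated_of_norm_le_one hε N (fun c hc => hS c (hN c hc)) hsep⟩
  intro x hx
  by_contra! hcon
  have hxN : x ∉ N := fun h => by
    have := hcon x h
    simp only [sub_self, norm_zero] at this
    linarith
  have hmem : (insert x N).card ∈ C := by
    refine ⟨insert x N, ?_, ?_, rfl⟩
    · intro y hy
      rcases Finset.mem_insert.1 hy with rfl | hy
      · exact hx
      · exact hN y hy
    · intro c hc d hd hcd
      rcases Finset.mem_insert.1 hc with hc' | hc' <;>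
        rcases Finset.mem_insert.1 hd with hd' | hd'
      · exact absurd (hc'.trans hd'.symm) hcd
      · rw [hc']
        exact (hcon d hd').le
      · rw [hd', norm_sub_rev]
        exact (hcon c hc').le
      · exact hsep c hc' d hd' hcd
  have := le_csSup hCb hmem
  rw [Finset.card_insert_of_notMem hxN, hcard] at this
  omega

end

section

variable {m : ℕ} {E : Type*} [NormedAddCommGroup E] [NormedSpace ℝ E]

lemma norm_le_two_mul_of_net {G : Type*} [NormedAddCommGroup G] [NormedSpace ℝ G]
    (T : E →L[ℝ] G) {R : ℝ} (hR : 0 ≤ R) {N : Finset E} (hN : ∀ x ∈ N, ‖T x‖ ≤ R)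
    (hnet : ∀ x : E, ‖x‖ = 1 → ∃ y ∈ N, ‖x - y‖ ≤ 1 / 2) : ‖T‖ ≤ 2 * R := by
  have h : ‖T‖ ≤ R + ‖T‖ * (1 / 2) := by
    refine T.opNorm_le_bound (by positivity) fun x => ?_
    rcases eq_or_ne x 0 with rfl | hx
    · simp
    have hx0 : 0 < ‖x‖ := norm_pos_iff.2 hx
    have hunit : ‖‖x‖⁻¹ • x‖ = 1 := norm_smul_inv_norm hx
    obtain ⟨y, hy, hxy⟩ := hnet _ hunit
    have h1 : ‖T (‖x‖⁻¹ • x)‖ ≤ R + ‖T‖ * (1 / 2) := by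
      calc ‖T (‖x‖⁻¹ • x)‖ = ‖T y + T (‖x‖⁻¹ • x - y)‖ := by rw [← map_add]; simp
        _ ≤ ‖T y‖ + ‖T (‖x‖⁻¹ • x - y)‖ := norm_add_le _ _
        _ ≤ R + ‖T‖ * (1 / 2) := by
          gcongr
          · exact hN y hy
          · exact (T.le_opNorm _).trans (by gcongr)
    rw [map_smul, norm_smul, norm_inv, norm_norm, inv_mul_le_iff₀ hx0] at h1
    linarith
  linarith

lemma sum_abs_mul_le_norm_mul_norm (x y : EuclideanSpace ℝ (Fin m)) :
    ∑ i, |x i * y i| ≤ ‖x‖ * ‖y‖ := by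
  refine abs_le_of_sq_le_sq' ?_ (by positivity) |>.2
  have h := Finset.sum_mul_sq_le_sq_mul_sq Finset.univ (fun i => |x i|) (fun i => |y i|)
  simp only [sq_abs] at h
  rw [mul_pow, EuclideanSpace.real_norm_sq_eq, EuclideanSpace.real_norm_sq_eq]
  simpa only [abs_mul] using h

lemma sum_abs_mul_le_of_approx (T : E →L[ℝ] EuclideanSpace ℝ (Fin m)) {R ε : ℝ}
    (hT : ‖T‖ ≤ R) {v w v' w' : E} (hw : ‖w‖ ≤ 1) (hv' : ‖v'‖ ≤ 1)
    (hvv : ‖v - v'‖ ≤ ε) (hww : ‖w - w'‖ ≤ ε) :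
    ∑ i, |T v' i * T w' i| ≤ ∑ i, |T v i * T w i| + 2 * ε * R ^ 2 := by
  have hR : 0 ≤ R := (norm_nonneg _).trans hT
  have hε : 0 ≤ ε := (norm_nonneg _).trans hvv
  have hb : ∀ {x : E} {r : ℝ}, ‖x‖ ≤ r → ‖T x‖ ≤ R * r := fun {x r} hx =>
    (T.le_opNorm x).trans (by gcongr)
  have h1 := sum_abs_mul_le_norm_mul_norm (T (v - v')) (T w)
  have h2 := sum_abs_mul_le_norm_mul_norm (T v') (T (w - w'))
  have h3 : ‖T (v - v')‖ * ‖T w‖ ≤ (R * ε) * (R * 1) :=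
    mul_le_mul (hb hvv) (hb hw) (norm_nonneg _) (by positivity)
  have h4 : ‖T v'‖ * ‖T (w - w')‖ ≤ (R * 1) * (R * ε) :=
    mul_le_mul (hb hv') (hb hww) (norm_nonneg _) (by positivity)
  have h5 : ∑ i, |T v' i * T w' i| ≤
      ∑ i, |T v i * T w i| + ∑ i, |T (v - v') i * T w i| + ∑ i, |T v' i * T (w - w') i| := by
    rw [← Finset.sum_add_distrib, ← Finset.sum_add_distrib]
    refine Finset.sum_le_sum fun i _ => ?_
    have e : T v' i * T w' i =
        T v i * T w i - T (v - v') i * T w i - T v' i * T (w - w') i := by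
      simp only [map_sub, PiLp.sub_apply]
      ring
    rw [e]
    exact (abs_sub _ _).trans (add_le_add_left (abs_sub _ _) _)
  nlinarith

end

/-! ### Uniform lower bound on a subspace -/

/-- The mesh of the net on which the lower bound for fixed vectors is applied; it is chosen so that
passing to the net costs at most half of that bound. -/
noncomputable def netMesh (L : ℝ) : ℝ := 1 / (49152 * L ^ 2 * momentConst L)

/-- The rate `κ` in the bound `exp (-κ m)` for the probability that the lower bound for fixed
vectors fails; `κ m` is also that lower bound. -/
noncomputable def failRate (L : ℝ) : ℝ := 1 / (16 * momentConst L)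

/-- The metric entropy per dimension of the nets entering the union bound: two nets of mesh
`netMesh L`, or one of mesh `1 / 2`, which accounts for the summand `5`. -/
noncomputable def entropyConst (L : ℝ) : ℝ := 2 * Real.log (5 + 2 / netMesh L)

/-- The lower bound `∑ |(A v)_i (A w)_i| ≥ (failRate L / 2) m` for all unit vectors `v`, `w` of the
subspace `F` such that all coordinates of `w` are at most `1 / 2` in modulus. -/
def ProductBound {m n : ℕ} (A : Matrix (Fin m) (Fin n) ℝ) (L : ℝ)
    (F : Submodule ℝ (EuclideanSpace ℝ (Fin n))) : Prop :=
  ∀ v ∈ F, ∀ w ∈ F, ‖v‖ = 1 → ‖w‖ = 1 → (∀ j, w j ^ 2 ≤ 1 / 4) →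
    failRate L / 2 * m ≤ ∑ i, |(A *ᵥ v.ofLp) i * (A *ᵥ w.ofLp) i|

section

variable {Ω Ω' : Type*} [MeasurableSpace Ω] [MeasurableSpace Ω'] {m n : ℕ}
  {A : Ω → Matrix (Fin m) (Fin n) ℝ} {P : Measure Ω} [IsProbabilityMeasure P]
  {a : Ω' → Fin n → ℝ} {Q : Measure Ω'} [IsProbabilityMeasure Q] {L : ℝ}

lemma failRate_pos (L : ℝ) : 0 < failRate L := by
  have := one_le_momentConst L
  unfold failRate
  positivity

lemma failRate_le_one (L : ℝ) : failRate L ≤ 1 := by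
  have := one_le_momentConst L
  unfold failRate
  rw [div_le_one (by positivity)]
  linarith

lemma netMesh_pos (hL : 0 < L) : 0 < netMesh L := by
  have := one_le_momentConst L
  unfold netMesh
  positivity

lemma entropyConst_pos (hL : 0 < L) : 0 < entropyConst L := by
  have := netMesh_pos hL
  have h : 0 < 2 / netMesh L := by positivity
  exact mul_pos two_pos (Real.log_pos (by linarith))

lemma exp_entropyConst_mul (hL : 0 < L) (d : ℕ) :
    Real.exp (entropyConst L * d) = ((5 + 2 / netMesh L) ^ d) ^ 2 := by
  have := netMesh_pos hL
  have h : 0 < 2 / netMesh L := by positivity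
  rw [mul_comm, Real.exp_nat_mul, entropyConst, ← pow_mul, mul_comm d 2, pow_mul]
  congr 1
  rw [show (2 : ℝ) = (2 : ℕ) by norm_num, Real.exp_nat_mul, Real.exp_log (by positivity)]

/-- Union bound over nets: `N₀` controls the operator norm of `A` on `F`, and the lower bound for
fixed vectors is applied on `N₁ × N₂`. -/
theorem HasIIDRows.measureReal_not_productBound_le (hA : HasIIDRows A P a Q)
    (ha : IsSubgaussianVector a L Q) (hL : 0 < L)
    (F : Submodule ℝ (EuclideanSpace ℝ (Fin n))) :
    P.real {ω | ¬ ProductBound (A ω) L F} ≤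
      2 * Real.exp (entropyConst L * Module.finrank ℝ F - failRate L * m) := by
  set ε := netMesh L with hεdef
  set d := Module.finrank ℝ F with hd
  have hε : 0 < ε := netMesh_pos hL
  have hM := one_le_momentConst L
  have hq : (5 : ℝ) ≤ 5 + 2 / ε := by
    have : 0 < 2 / ε := by positivity
    linarith
  obtain ⟨N₀, hN₀S, hN₀, hN₀c⟩ := exists_net (E := F) (ε := 1 / 2) (by norm_num)
    (S := {x | ‖x‖ = 1}) fun x (hx : ‖x‖ = 1) => hx.le
  obtain ⟨N₁, hN₁S, hN₁, hN₁c⟩ := exists_net (E := F) hε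
    (S := {x | ‖x‖ = 1}) fun x (hx : ‖x‖ = 1) => hx.le
  obtain ⟨N₂, hN₂S, hN₂, hN₂c⟩ := exists_net (E := F) hε
    (S := {x | ‖x‖ = 1 ∧ ∀ j, (x : EuclideanSpace ℝ (Fin n)) j ^ 2 ≤ 1 / 4})
    fun x (hx : ‖x‖ = 1 ∧ _) => hx.1.le
  let B₀ : F → Set Ω := fun x =>
    {ω | 192 * L ^ 2 * m ≤ ∑ i, ((A ω *ᵥ (x : EuclideanSpace ℝ (Fin n)).ofLp) i) ^ 2}
  let B₁ : F × F → Set Ω := fun x =>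
    {ω | ∑ i, |(A ω *ᵥ (x.1 : EuclideanSpace ℝ (Fin n)).ofLp) i *
      (A ω *ᵥ (x.2 : EuclideanSpace ℝ (Fin n)).ofLp) i| ≤ m / (16 * momentConst L)}
  have hsub : {ω | ¬ ProductBound (A ω) L F} ⊆
      (⋃ x ∈ N₀, B₀ x) ∪ ⋃ x ∈ N₁ ×ˢ N₂, B₁ x := by
    intro ω hω
    by_contra hcon
    simp only [Set.mem_union, Set.mem_iUnion, not_or, not_exists, B₀, B₁, Set.mem_ofPred_eq,
      not_le] at hcon hω
    refine hω fun v hv w hw hv1 hw1 hflat => ?_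
    let T : F →L[ℝ] EuclideanSpace ℝ (Fin m) :=
      LinearMap.toContinuousLinearMap (Matrix.toLpLin 2 2 (A ω) ∘ₗ F.subtype)
    have hTapp : ∀ x : F, T x = WithLp.toLp 2 (A ω *ᵥ (x : EuclideanSpace ℝ (Fin n)).ofLp) :=
      fun x => rfl
    have hTn : ‖T‖ ≤ 2 * √(192 * L ^ 2 * m) := by
      refine norm_le_two_mul_of_net T (Real.sqrt_nonneg _) (N := N₀) (fun x hx => ?_)
        fun x hx => hN₀ x hx
      apply Real.le_sqrt_of_sq_le
      rw [EuclideanSpace.real_norm_sq_eq, hTapp]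
      exact (hcon.1 x hx).le
    obtain ⟨v', hv', hvv⟩ := hN₁ ⟨v, hv⟩ hv1
    obtain ⟨w', hw', hww⟩ := hN₂ ⟨w, hw⟩ ⟨hw1, hflat⟩
    have h1 := sum_abs_mul_le_of_approx T hTn (v := ⟨v, hv⟩) (w := ⟨w, hw⟩) (hw1.le)
      (show ‖v'‖ = 1 from hN₁S v' hv').le hvv hww
    simp only [hTapp] at h1
    have h2 := hcon.2 (v', w') (Finset.mem_product.2 ⟨hv', hw'⟩)
    rw [mul_pow, Real.sq_sqrt (by positivity)] at h1
    have h3 : 2 * ε * (2 ^ 2 * (192 * L ^ 2 * m)) = m / (32 * momentConst L) := by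
      rw [hεdef, netMesh]
      field_simp
      ring
    have h4 : failRate L / 2 * m = m / (16 * momentConst L) - m / (32 * momentConst L) := by
      rw [failRate]
      field_simp
      ring
    linarith
  have hP₀ : P.real (⋃ x ∈ N₀, B₀ x) ≤ Real.exp (entropyConst L * d - failRate L * m) := by
    calc P.real (⋃ x ∈ N₀, B₀ x) ≤ ∑ x ∈ N₀, P.real (B₀ x) := measureReal_biUnion_finset_le _ _
      _ ≤ ∑ _x ∈ N₀, Real.exp (-(failRate L * m)) := by
          refine Finset.sum_le_sum fun x hx => ?_
          refine (hA.measureReal_sum_sq_ge_le ha hL (show ‖x‖ = 1 from hN₀S x hx)).trans ?_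
          rw [Real.exp_le_exp, neg_le_neg_iff]
          exact mul_le_of_le_one_left (Nat.cast_nonneg m) (failRate_le_one L)
      _ = N₀.card * Real.exp (-(failRate L * m)) := by simp
      _ ≤ ((5 + 2 / ε) ^ d) ^ 2 * Real.exp (-(failRate L * m)) := by
          gcongr
          refine hN₀c.trans ?_
          have h1 : (1 + 2 / (1 / 2) : ℝ) ^ d ≤ (5 + 2 / ε) ^ d := by
            rw [show (1 + 2 / (1 / 2) : ℝ) = 5 by norm_num]
            exact pow_le_pow_left₀ (by norm_num) hq d
          have h2 : 1 ≤ (5 + 2 / ε) ^ d := one_le_pow₀ (by linarith)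
          nlinarith
      _ = _ := by rw [← exp_entropyConst_mul hL, ← Real.exp_add, ← sub_eq_add_neg]
  have hP₁ : P.real (⋃ x ∈ N₁ ×ˢ N₂, B₁ x) ≤ Real.exp (entropyConst L * d - failRate L * m) := by
    calc P.real (⋃ x ∈ N₁ ×ˢ N₂, B₁ x) ≤ ∑ x ∈ N₁ ×ˢ N₂, P.real (B₁ x) :=
          measureReal_biUnion_finset_le _ _
      _ ≤ ∑ _x ∈ N₁ ×ˢ N₂, Real.exp (-(failRate L * m)) := by
          refine Finset.sum_le_sum fun x hx => ?_
          obtain ⟨h1, h2⟩ := Finset.mem_product.1 hx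
          refine (hA.measureReal_sum_abs_mul_le_le ha hL (show ‖x.1‖ = 1 from hN₁S _ h1)
            (hN₂S _ h2).1 (hN₂S _ h2).2).trans_eq ?_
          rw [failRate]
          ring_nf
      _ = N₁.card * N₂.card * Real.exp (-(failRate L * m)) := by simp
      _ ≤ (5 + 2 / ε) ^ d * (5 + 2 / ε) ^ d * Real.exp (-(failRate L * m)) := by
          have h1 : (1 + 2 / ε) ^ d ≤ (5 + 2 / ε) ^ d := by
            gcongr
            norm_num
          gcongr
          · exact hN₁c.trans h1
          · exact hN₂c.trans h1
      _ = _ := by rw [← sq, ← exp_entropyConst_mul hL, ← Real.exp_add, ← sub_eq_add_neg]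
  have := (measureReal_mono (μ := P) hsub).trans (measureReal_union_le _ _)
  linarith

end

/-! ### Stability -/

section

variable {m n : ℕ}

lemma IsFlat.abs_apply_le {μ : ℝ} {x : EuclideanSpace ℝ (Fin n)} (hx : IsFlat μ x) (j : Fin n) :
    |x j| ≤ μ * ‖x‖ :=
  (norm_le_pi_norm x.ofLp j).trans hx

lemma sq_apply_add_le_of_isFlat {μ : ℝ} (hμ : 8 * μ ^ 2 ≤ 1) {s t z : EuclideanSpace ℝ (Fin n)}
    (hs : IsFlat μ s) (ht : IsFlat μ t) (hz : ∀ j, |z j| ≤ |s j| + |t j|)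
    (hsz : ‖s - t‖ ^ 2 + ‖s + t‖ ^ 2 ≤ 2 * ‖z‖ ^ 2) (j : Fin n) :
    z j ^ 2 ≤ 1 / 4 * ‖z‖ ^ 2 := by
  have h1 : |z j| ≤ μ * (‖s‖ + ‖t‖) := by
    have := hs.abs_apply_le j
    have := ht.abs_apply_le j
    have := hz j
    linarith
  have h2 : z j ^ 2 ≤ μ ^ 2 * (‖s‖ + ‖t‖) ^ 2 := by
    rw [← sq_abs, ← mul_pow]
    gcongr
  have h3 := parallelogram_law_with_norm ℝ s t
  have h4 : (‖s‖ + ‖t‖) ^ 2 ≤ 2 * ‖z‖ ^ 2 := by nlinarith [sq_nonneg (‖s‖ - ‖t‖)]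
  nlinarith [sq_nonneg μ, sq_nonneg ‖z‖]

lemma ProductBound.mul_norm_le {A : Matrix (Fin m) (Fin n) ℝ} {L : ℝ}
    {F : Submodule ℝ (EuclideanSpace ℝ (Fin n))} (h : ProductBound A L F)
    {v w : EuclideanSpace ℝ (Fin n)} (hv : v ∈ F) (hw : w ∈ F)
    (hflat : ∀ j, w j ^ 2 ≤ 1 / 4 * ‖w‖ ^ 2) :
    failRate L / 2 * m * ‖v‖ * ‖w‖ ≤ ∑ i, |(A *ᵥ v.ofLp) i * (A *ᵥ w.ofLp) i| := by
  rcases eq_or_ne v 0 with rfl | hv0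
  · simp
  rcases eq_or_ne w 0 with rfl | hw0
  · simp
  have hvp : 0 < ‖v‖ := norm_pos_iff.2 hv0
  have hwp : 0 < ‖w‖ := norm_pos_iff.2 hw0
  have h1 := h (‖v‖⁻¹ • v) (F.smul_mem _ hv) (‖w‖⁻¹ • w) (F.smul_mem _ hw)
    (norm_smul_inv_norm hv0) (norm_smul_inv_norm hw0) fun j => by
      simp only [PiLp.smul_apply, smul_eq_mul, mul_pow, inv_pow]
      rw [inv_mul_le_iff₀ (by positivity), mul_comm]
      exact hflat j
  have h2 : ∀ i, |(A *ᵥ (‖v‖⁻¹ • v).ofLp) i * (A *ᵥ (‖w‖⁻¹ • w).ofLp) i| =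
      |(A *ᵥ v.ofLp) i * (A *ᵥ w.ofLp) i| / (‖v‖ * ‖w‖) := fun i => by
    simp only [WithLp.ofLp_smul, Matrix.mulVec_smul, Pi.smul_apply, smul_eq_mul, abs_mul, abs_inv,
      abs_norm]
    field_simp
  simp only [h2] at h1
  rw [← Finset.sum_div, le_div_iff₀ (by positivity)] at h1
  linarith

lemma l1norm_phi_sub (A : Matrix (Fin m) (Fin n) ℝ) (s t : EuclideanSpace ℝ (Fin n)) :
    l1norm (phi (A *ᵥ s.ofLp) - phi (A *ᵥ t.ofLp)) =
      ∑ i, |(A *ᵥ (s - t).ofLp) i * (A *ᵥ (s + t).ofLp) i| := by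
  refine Finset.sum_congr rfl fun i _ => ?_
  simp only [phi, Pi.sub_apply, sq_abs, WithLp.ofLp_sub, WithLp.ofLp_add, Matrix.mulVec_sub,
    Matrix.mulVec_add, Pi.add_apply]
  ring_nf

/-- The longer of the two vectors `s - t`, `s + t` inherits enough flatness from `s` and `t` for
`ProductBound` to apply to the pair. -/
lemma ProductBound.le_l1norm {A : Matrix (Fin m) (Fin n) ℝ} {L μ : ℝ}
    {F : Submodule ℝ (EuclideanSpace ℝ (Fin n))} (h : ProductBound A L F) (hμ : 8 * μ ^ 2 ≤ 1)
    {s t : EuclideanSpace ℝ (Fin n)} (hs : s ∈ F) (ht : t ∈ F) (hsμ : IsFlat μ s)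
    (htμ : IsFlat μ t) :
    failRate L / 2 * m * ‖s - t‖ * ‖s + t‖ ≤
      l1norm (phi (A *ᵥ s.ofLp) - phi (A *ᵥ t.ofLp)) := by
  rw [l1norm_phi_sub]
  rcases le_total ‖s - t‖ ‖s + t‖ with hle | hle
  · refine h.mul_norm_le (F.sub_mem hs ht) (F.add_mem hs ht) ?_
    refine sq_apply_add_le_of_isFlat hμ hsμ htμ (fun j => abs_add_le _ _) ?_
    have := pow_le_pow_left₀ (norm_nonneg _) hle 2
    linarith
  · have h1 := h.mul_norm_le (F.add_mem hs ht) (F.sub_mem hs ht) <|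
      sq_apply_add_le_of_isFlat hμ hsμ htμ (fun j => abs_sub _ _) (by
        have := pow_le_pow_left₀ (norm_nonneg _) hle 2
        linarith)
    simp only [mul_comm ((A *ᵥ (s - t).ofLp) _)]
    linarith

lemma ProductBound.mul_norm_sub_mul_norm_add_le {A : Matrix (Fin m) (Fin n) ℝ} {L μ : ℝ}
    {F : Submodule ℝ (EuclideanSpace ℝ (Fin n))} (h : ProductBound A L F) (hm : 0 < m)
    (hμ : 8 * μ ^ 2 ≤ 1) {s t : EuclideanSpace ℝ (Fin n)} (hs : s ∈ F) (ht : t ∈ F)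
    (hsμ : IsFlat μ s) (htμ : IsFlat μ t) :
    failRate L / 2 * √(1 - 8 * μ ^ 2) * ‖s - t‖ * ‖s + t‖ ≤
      l1norm (phi (A *ᵥ s.ofLp) - phi (A *ᵥ t.ofLp)) := by
  refine le_trans ?_ (h.le_l1norm hμ hs ht hsμ htμ)
  have h1 : √(1 - 8 * μ ^ 2) ≤ m := by
    refine (Real.sqrt_le_one.2 (by nlinarith [sq_nonneg μ])).trans ?_
    exact_mod_cast hm
  have := failRate_pos L
  gcongr

/-- The subspace of vectors supported in `J`. -/
def coordSubspace (J : Finset (Fin n)) : Submodule ℝ (EuclideanSpace ℝ (Fin n)) where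
  carrier := {x | ∀ j, j ∉ J → x j = 0}
  add_mem' hx hy j hj := by simp [hx j hj, hy j hj]
  zero_mem' j _ := by simp
  smul_mem' c x hx j hj := by simp [hx j hj]

lemma mem_coordSubspace {J : Finset (Fin n)} {x : EuclideanSpace ℝ (Fin n)} :
    x ∈ coordSubspace J ↔ ∀ j, j ∉ J → x j = 0 := Iff.rfl

lemma finrank_coordSubspace_le (J : Finset (Fin n)) :
    Module.finrank ℝ (coordSubspace J) ≤ J.card := by
  let f : coordSubspace J →ₗ[ℝ] (J → ℝ) :=
    { toFun := fun x j => (x : EuclideanSpace ℝ (Fin n)) j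
      map_add' := fun x y => rfl
      map_smul' := fun c x => rfl }
  have hf : Function.Injective f := by
    intro x y hxy
    ext j
    by_cases hj : j ∈ J
    · exact congrFun hxy ⟨j, hj⟩
    · rw [mem_coordSubspace.1 x.2 j hj, mem_coordSubspace.1 y.2 j hj]
  simpa using LinearMap.finrank_le_finrank_of_injective hf

lemma IsSparse.exists_mem_coordSubspace {k : ℕ} (hk : k ≤ n) {x : EuclideanSpace ℝ (Fin n)}
    (hx : IsSparse k x) :
    ∃ J ∈ Finset.powersetCard k (Finset.univ : Finset (Fin n)), x ∈ coordSubspace J := by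
  classical
  have h1 : (Finset.univ.filter fun j => x j ≠ 0).card ≤ k := by
    refine le_trans (le_of_eq ?_) hx
    rw [← Set.ncard_coe_finset]
    simp
  obtain ⟨J, hJ, hJk⟩ := Finset.exists_superset_card_eq h1 (by simpa using hk)
  refine ⟨J, Finset.mem_powersetCard.2 ⟨Finset.subset_univ _, hJk⟩, fun j hj => ?_⟩
  by_contra hne
  exact hj (hJ (by simpa using hne))

lemma coordSubspace_mono {J K : Finset (Fin n)} (h : J ⊆ K) :
    coordSubspace J ≤ coordSubspace K :=
  fun _ hx j hj => hx j fun hJ => hj (h hJ)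

lemma choose_le_exp_mul_log {k n : ℕ} (hk : 1 ≤ k) (hkn : k ≤ n) :
    (n.choose k : ℝ) ≤ Real.exp (k * Real.log (Real.exp 1 * n / k)) := by
  have hk0 : (0 : ℝ) < k := by exact_mod_cast hk
  have hn0 : (0 : ℝ) < n := by exact_mod_cast hk.trans hkn
  have h1 := Real.pow_div_factorial_le_exp (k : ℝ) hk0.le k
  have hf : (0 : ℝ) < k.factorial := by exact_mod_cast k.factorial_pos
  rw [Real.exp_nat_mul, Real.exp_log (by positivity)]
  calc (n.choose k : ℝ) ≤ n ^ k / k.factorial := Nat.choose_le_pow_div k n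
    _ = (n / k) ^ k * (k ^ k / k.factorial) := by
        rw [div_pow]
        field_simp
    _ ≤ (n / k) ^ k * Real.exp k := by gcongr
    _ = (Real.exp 1 * n / k) ^ k := by
        rw [show Real.exp (k : ℝ) = Real.exp 1 ^ k by rw [← Real.exp_nat_mul, mul_one], ← mul_pow]
        ring_nf

end

section

variable {Ω Ω' : Type*} [MeasurableSpace Ω] [MeasurableSpace Ω'] {m n : ℕ}
  {A : Ω → Matrix (Fin m) (Fin n) ℝ} {P : Measure Ω} [IsProbabilityMeasure P]
  {a : Ω' → Fin n → ℝ} {Q : Measure Ω'} [IsProbabilityMeasure Q] {L μ : ℝ}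

/-- Neither set need be measurable: subadditivity suffices. -/
lemma one_sub_le_measureReal {G B : Set Ω} {p : ℝ} (hB : P.real B ≤ p) (h : Bᶜ ⊆ G) :
    1 - p ≤ P.real G := by
  have h1 : (Set.univ : Set Ω) ⊆ B ∪ G := fun ω _ => by
    by_cases hω : ω ∈ B
    · exact Or.inl hω
    · exact Or.inr (h hω)
  have h2 := (measureReal_mono (μ := P) h1).trans (measureReal_union_le _ _)
  rw [probReal_univ] at h2
  linarith

lemma HasIIDRows.isStable_flatSet (hA : HasIIDRows A P a Q) (ha : IsSubgaussianVector a L Q)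
    (hL : 0 < L) (hm : 0 < m) (hμ : 8 * μ ^ 2 ≤ 1) :
    1 - 2 * Real.exp (entropyConst L * n - failRate L * m) ≤
      P.real {ω | IsStable (A ω) (failRate L / 2 * √(1 - 8 * μ ^ 2)) (flatSet n μ)} := by
  have h := hA.measureReal_not_productBound_le ha hL ⊤
  rw [finrank_top, finrank_euclideanSpace_fin] at h
  refine one_sub_le_measureReal h fun ω hω s hs t ht => ?_
  have hω' : ProductBound (A ω) L ⊤ := by simpa using hω
  exact hω'.mul_norm_sub_mul_norm_add_le hm hμ trivial trivial hs ht

lemma HasIIDRows.isStable_flatSparseSet (hA : HasIIDRows A P a Q)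
    (ha : IsSubgaussianVector a L Q) (hL : 0 < L) (hm : 0 < m) (hμ : 8 * μ ^ 2 ≤ 1) {k : ℕ}
    (hk : 1 ≤ k) (hkn : k ≤ n) :
    1 - 2 * Real.exp (2 * (k * Real.log (Real.exp 1 * n / k)) + entropyConst L * (2 * k)
        - failRate L * m) ≤
      P.real {ω | IsStable (A ω) (failRate L / 2 * √(1 - 8 * μ ^ 2)) (flatSparseSet n μ k)} := by
  classical
  set I := Finset.powersetCard k (Finset.univ : Finset (Fin n)) with hI
  have hIc : (I.card : ℝ) ≤ Real.exp (k * Real.log (Real.exp 1 * n / k)) := by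
    rw [hI, Finset.card_powersetCard, Finset.card_univ, Fintype.card_fin]
    exact choose_le_exp_mul_log hk hkn
  -- two `k`-sparse vectors lie in a common coordinate subspace of dimension at most `2 k`
  let B : Finset (Fin n) × Finset (Fin n) → Set Ω := fun J =>
    {ω | ¬ ProductBound (A ω) L (coordSubspace (J.1 ∪ J.2))}
  have hB : P.real (⋃ J ∈ I ×ˢ I, B J) ≤
      2 * Real.exp (2 * (k * Real.log (Real.exp 1 * n / k)) + entropyConst L * (2 * k)
        - failRate L * m) := by
    calc P.real (⋃ J ∈ I ×ˢ I, B J) ≤ ∑ J ∈ I ×ˢ I, P.real (B J) :=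
          measureReal_biUnion_finset_le _ _
      _ ≤ ∑ _J ∈ I ×ˢ I, 2 * Real.exp (entropyConst L * (2 * k) - failRate L * m) := by
          refine Finset.sum_le_sum fun J hJ => ?_
          obtain ⟨h1, h2⟩ := Finset.mem_product.1 hJ
          refine (hA.measureReal_not_productBound_le ha hL _).trans ?_
          have hc : Module.finrank ℝ (coordSubspace (J.1 ∪ J.2)) ≤ 2 * k := by
            refine (finrank_coordSubspace_le _).trans ((Finset.card_union_le _ _).trans ?_)
            rw [(Finset.mem_powersetCard.1 h1).2, (Finset.mem_powersetCard.1 h2).2, two_mul]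
          have hc' : (Module.finrank ℝ (coordSubspace (J.1 ∪ J.2)) : ℝ) ≤ 2 * k := by
            exact_mod_cast hc
          have := entropyConst_pos hL
          gcongr
      _ = I.card * I.card * (2 * Real.exp (entropyConst L * (2 * k) - failRate L * m)) := by simp
      _ ≤ Real.exp (k * Real.log (Real.exp 1 * n / k)) *
            Real.exp (k * Real.log (Real.exp 1 * n / k)) *
            (2 * Real.exp (entropyConst L * (2 * k) - failRate L * m)) := by gcongr
      _ = _ := by
          rw [mul_left_comm, ← Real.exp_add, ← Real.exp_add]
          ring_nf
  refine one_sub_le_measureReal hB fun ω hω s hs t ht => ?_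
  obtain ⟨J, hJ, hsJ⟩ := hs.1.exists_mem_coordSubspace hkn
  obtain ⟨K, hK, htK⟩ := ht.1.exists_mem_coordSubspace hkn
  have hω' : ProductBound (A ω) L (coordSubspace (J ∪ K)) := by
    by_contra hcon
    exact hω (Set.mem_biUnion (Finset.mem_product.2 ⟨hJ, hK⟩ : (J, K) ∈ I ×ˢ I) hcon)
  exact hω'.mul_norm_sub_mul_norm_add_le hm hμ (coordSubspace_mono Finset.subset_union_left hsJ)
    (coordSubspace_mono Finset.subset_union_right htK) hs.2 ht.2

end

lemma mul_sq_le_of_mul_pow_three_div_le {c u x δ y : ℝ} (hc : 0 ≤ c) (hu : 1 ≤ u) (hx : 0 ≤ x)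
    (hδ0 : 0 < δ) (hδ1 : δ ≤ 1) (h : c * u ^ 3 * (x / δ) ≤ y) : c * (u ^ 2 * x) ≤ y := by
  refine le_trans ?_ h
  have h1 : u ^ 2 ≤ u ^ 3 := pow_le_pow_right₀ hu (by norm_num)
  have h2 : x ≤ x / δ := le_div_self hx hδ0 hδ1
  rw [mul_assoc]
  gcongr

end PhaseRetrieval

theorem mainTheorem3 (L : ℝ) (hL : 0 < L) :
    ∃ c₁ c₂ c₃ c₄ c₅ c₆ c₇ c₈ : ℝ,
      (0 < c₁ ∧ 0 < c₂ ∧ 0 < c₃ ∧ 0 < c₄ ∧ 0 < c₅ ∧ 0 < c₆ ∧ 0 < c₇ ∧ 0 < c₈) ∧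
      ∀ (μ : ℝ), 0 < μ → μ < 1 / (2 * Real.sqrt 2) →
      ∀ (n m : ℕ)
        (Ω' : Type*) [MeasurableSpace Ω'] (Q : MeasureTheory.Measure Ω')
        [MeasureTheory.IsProbabilityMeasure Q] (a : Ω' → Fin n → ℝ)
        (Ω : Type*) [MeasurableSpace Ω] (P : MeasureTheory.Measure Ω)
        [MeasureTheory.IsProbabilityMeasure P] (A : Ω → Matrix (Fin m) (Fin n) ℝ),
        PhaseRetrieval.IsSubgaussianVector a L Q →
        PhaseRetrieval.HasIIDRows A P a Q →
        (∀ u : ℝ, c₁ ≤ u →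
          c₂ * u ^ 3 * ((n : ℝ) / (1 - 8 * μ ^ 2)) ≤ (m : ℝ) →
          1 - 2 * Real.exp (-(c₃ * u ^ 2 * (n : ℝ))) ≤
            P.real {ω | PhaseRetrieval.IsStable (A ω) (c₄ * Real.sqrt (1 - 8 * μ ^ 2))
              (PhaseRetrieval.flatSet n μ)}) ∧
        (∀ k : ℕ, 1 ≤ k → k ≤ n → ∀ u : ℝ, c₅ ≤ u →
          c₆ * u ^ 3 * ((k : ℝ) * Real.log (Real.exp 1 * (n : ℝ) / (k : ℝ)) / (1 - 8 * μ ^ 2))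
            ≤ (m : ℝ) →
          1 - 2 * Real.exp
              (-(c₇ * u ^ 2 * ((k : ℝ) * Real.log (Real.exp 1 * (n : ℝ) / (k : ℝ))))) ≤
            P.real {ω | PhaseRetrieval.IsStable (A ω) (c₈ * Real.sqrt (1 - 8 * μ ^ 2))
              (PhaseRetrieval.flatSparseSet n μ k)}) := by
  open PhaseRetrieval in
  have hκ := failRate_pos L
  have hD := entropyConst_pos hL
  refine ⟨1, (entropyConst L + 1) / failRate L, 1, failRate L / 2, 1,
    (2 * entropyConst L + 3) / failRate L, 1, failRate L / 2,
    by refine ⟨?_, ?_, ?_, ?_, ?_, ?_, ?_, ?_⟩ <;> positivity, ?_⟩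
  intro μ hμ0 hμ n m Ω' _ Q _ a Ω _ P _ A ha hA
  have hμ8 : 8 * μ ^ 2 < 1 := by
    rw [lt_div_iff₀ (by positivity)] at hμ
    have h1 : (μ * (2 * √2)) ^ 2 < 1 := pow_lt_one₀ (by positivity) hμ two_ne_zero
    rw [mul_pow, mul_pow, Real.sq_sqrt zero_le_two] at h1
    linarith
  have hδ0 : 0 < 1 - 8 * μ ^ 2 := by linarith
  have hδ1 : 1 - 8 * μ ^ 2 ≤ 1 := by nlinarith [sq_nonneg μ]
  constructor
  · intro u hu hm
    rcases Nat.eq_zero_or_pos n with rfl | hn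
    · -- for `n = 0` the claimed bound is `-1`
      refine le_trans ?_ measureReal_nonneg
      norm_num
    have hn' : (0 : ℝ) < n := by exact_mod_cast hn
    have h1 := mul_sq_le_of_mul_pow_three_div_le (by positivity) hu hn'.le hδ0 hδ1 hm
    have hu2 : 1 ≤ u ^ 2 := one_le_pow₀ hu
    have hm0 : 0 < m := by
      have : (0 : ℝ) < m := lt_of_lt_of_le (by positivity) h1
      exact_mod_cast this
    refine le_trans ?_ (hA.isStable_flatSet ha hL hm0 hμ8.le)
    rw [div_mul_eq_mul_div, div_le_iff₀ hκ] at h1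
    have h2 : entropyConst L * n - failRate L * m ≤ -(1 * u ^ 2 * n) := by
      have h3 : entropyConst L * n ≤ entropyConst L * (u ^ 2 * n) := by
        gcongr
        exact le_mul_of_one_le_left hn'.le hu2
      linarith
    have := Real.exp_le_exp.2 h2
    linarith
  · intro k hk hkn u hu hm
    have hk' : (0 : ℝ) < k := by exact_mod_cast hk
    have hkn' : (k : ℝ) ≤ n := by exact_mod_cast hkn
    have hlog : 1 ≤ Real.log (Real.exp 1 * n / k) := by
      rw [Real.le_log_iff_exp_le (by have := hk'.trans_le hkn'; positivity), le_div_iff₀ hk']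
      gcongr
    set l := (k : ℝ) * Real.log (Real.exp 1 * n / k) with hl
    have hkl : (k : ℝ) ≤ l := le_mul_of_one_le_right hk'.le hlog
    have hl0 : 0 < l := hk'.trans_le hkl
    have h1 := mul_sq_le_of_mul_pow_three_div_le (by positivity) hu hl0.le hδ0 hδ1 hm
    have hu2 : 1 ≤ u ^ 2 := one_le_pow₀ hu
    have hm0 : 0 < m := by
      have : (0 : ℝ) < m := lt_of_lt_of_le (by positivity) h1
      exact_mod_cast this
    refine le_trans ?_ (hA.isStable_flatSparseSet ha hL hm0 hμ8.le hk hkn)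
    rw [div_mul_eq_mul_div, div_le_iff₀ hκ] at h1
    have h2 : 2 * l + entropyConst L * (2 * k) - failRate L * m ≤ -(1 * u ^ 2 * l) := by
      have hlu : l ≤ u ^ 2 * l := le_mul_of_one_le_left hl0.le hu2
      have h3 : entropyConst L * (2 * k) ≤ entropyConst L * (2 * (u ^ 2 * l)) := by
        gcongr
        exact hkl.trans hlu
      linarith
    have := Real.exp_le_exp.2 h2
    linarith
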